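/- Let $E$ be a smooth and uniformly convex real Banach space with dual $E^*$, where smooth means that $\lim_{t\to0}(\|x+ty\|-\|x\|)/t$ exists for all unit vectors $x,y\in E$. Let $J\colon E\to E^*$ be the normalized duality mapping, that is, $Jx$ is the unique $x^*\in E^*$ with $\langle x,x^*\rangle=\|x\|^2=\|x^*\|^2$; $J$ is a bijection. Put $\phi(x,y)=\|x\|^2-2\langle x,Jy\rangle+\|y\|^2$ for $x,y\in E$. For a nonempty closed convex set $D\subset E$ and $x\in E$, let $Q_D(x)$ be the unique point of $D$ with $\phi(Q_D(x),x)=\min\{\phi(y,x):y\in D\}$. Let $C$ be a nonempty closed convex subset of $E$ and let $\{S_n\}_{n\ge1}$ be a sequence of mappings of $C$ into $E$ such that $F=\bigcap_{n\ge1}F(S_n)$ is nonempty, where $F(T)=\{p\in C: Tp=p\}$. Suppose that (i) $\{S_n\}$ is a strongly relatively nonexpansive sequence: for every $n$, $F(S_n)\neq\emptyset$ and $\phi(p,S_nx)\le\phi(p,x)$ for all $x\in C$ and $p\in F(S_n)$; and $\phi(S_nz_n,z_n)\to0$ whenever $\{z_n\}$ is a bounded sequence in $C$ and $\phi(p,z_n)-\phi(p,S_nz_n)\to0$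 for some $p\in F$; (ii) $\{S_n\}$ satisfies condition (Z): whenever $\{z_n\}$ is a bounded sequence in $C$ with $S_nz_n-z_n\to0$, every weak cluster point of $\{z_n\}$ belongs to $F$. Let $\{\alpha_n\}_{n\ge1}$ be a sequence in $(0,1]$ with $\alpha_n\to0$ and $\sum_{n=1}^\infty\alpha_n=\infty$. Let $u\in E$, let $x_1\in C$, and define $$x_{n+1}=Q_C\,J^{-1}\bigl(\alpha_nJu+(1-\alpha_n)JS_nx_n\bigr)\qquad(n\ge1).$$ Then there is a unique point of $F$ that minimizes $\phi(\cdot,u)$ over $F$, that is, $Q_F(u)$ is well defined, and $\{x_n\}$ converges strongly (in norm) to $Q_F(u)$. -/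

import Mathlib

open Filter Topology

noncomputable section

/-- The norm of `E` is Gateaux differentiable: the limit of `(‖x + t y‖ - ‖x‖) / t` as `t → 0`
exists for all `x`, `y` in the unit sphere. -/
def IsSmoothSpace (E : Type*) [NormedAddCommGroup E] [NormedSpace ℝ E] : Prop :=
  ∀ x y : E, ‖x‖ = 1 → ‖y‖ = 1 →
    ∃ l : ℝ, Tendsto (fun t : ℝ => (‖x + t • y‖ - ‖x‖) / t) (𝓝[≠] 0) (𝓝 l)

variable {E : Type*} [NormedAddCommGroup E] [NormedSpace ℝ E]

/-- The set-valued normalized duality mapping. -/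
def dualitySet (x : E) : Set (StrongDual ℝ E) :=
  {f | f x = ‖x‖ ^ 2 ∧ ‖f‖ ^ 2 = ‖x‖ ^ 2}

theorem dualitySet_nonempty (x : E) : (dualitySet x).Nonempty := by
  rcases eq_or_ne x 0 with rfl | hx
  · exact ⟨0, by simp [dualitySet]⟩
  · obtain ⟨g, hg, hgx⟩ := exists_dual_vector ℝ x (norm_ne_zero_iff.2 hx)
    refine ⟨‖x‖ • g, ?_, ?_⟩
    · simp [hgx, sq]
    · simp [norm_smul, hg]

/-- The single-valued duality mapping `J`. Its value is some element of the nonempty set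
`dualitySet x`; in a smooth space that set is a singleton, so nothing is chosen. -/
def dualityMap (x : E) : StrongDual ℝ E := (dualitySet_nonempty x).some

/-- The inverse `J⁻¹` (`J` is a bijection when `E` is smooth, strictly convex and reflexive). -/
def dualityInv : StrongDual ℝ E → E := Function.invFun dualityMap

/-- `φ(x, y) = ‖x‖² - 2⟨x, Jy⟩ + ‖y‖²`. -/
def lyapunov (x y : E) : ℝ := ‖x‖ ^ 2 - 2 * dualityMap y x + ‖y‖ ^ 2

/-- `x₀` is a point of `C` with `φ(x₀, x) = min {φ(y, x) : y ∈ C}`. -/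
def IsGeneralizedProjection (C : Set E) (x x₀ : E) : Prop :=
  x₀ ∈ C ∧ ∀ y ∈ C, lyapunov x₀ x ≤ lyapunov y x

open Classical in
/-- The generalized projection `Q_C`. In a smooth, strictly convex and reflexive Banach space the
minimizer exists and is unique for every nonempty closed convex `C`, and `Q_C(x)` is that minimizer;
the value `0` in the other case is never met there. -/
def generalizedProjection (C : Set E) (x : E) : E :=
  if h : ∃ x₀, IsGeneralizedProjection C x x₀ then h.choose else 0

/-- The fixed points of a mapping of `C` into `E`. A mapping of `C` into `E` is represented by a
function on `E` of which only the values on `C` are used. -/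
def fixedPointsOn (C : Set E) (T : E → E) : Set E := {p | p ∈ C ∧ T p = p}

/-- `F = ⋂ₙ F(Tₙ)`. -/
def commonFixedPoints (C : Set E) (T : ℕ → E → E) : Set E := ⋂ n, fixedPointsOn C (T n)

/-- Mappings `T : C → E` of type (r). -/
def IsTypeR (C : Set E) (T : E → E) : Prop :=
  (fixedPointsOn C T).Nonempty ∧
    ∀ x ∈ C, ∀ p ∈ fixedPointsOn C T, lyapunov p (T x) ≤ lyapunov p x

/-- Strongly relatively nonexpansive sequences of mappings of `C` into `E`. -/
def IsStronglyRelativelyNonexpansiveSeq (C : Set E) (T : ℕ → E → E) : Prop :=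
  (∀ n, IsTypeR C (T n)) ∧
    ∀ x : ℕ → E, (∀ n, x n ∈ C) → Bornology.IsBounded (Set.range x) →
      (∃ p ∈ commonFixedPoints C T,
        Tendsto (fun n => lyapunov p (x n) - lyapunov p (T n (x n))) atTop (𝓝 0)) →
      Tendsto (fun n => lyapunov (T n (x n)) (x n)) atTop (𝓝 0)

/-- `p` is a cluster point of the sequence `x` in the weak topology of `E`. -/
def IsWeakClusterPt (p : E) (x : ℕ → E) : Prop :=
  MapClusterPt (toWeakSpace ℝ E p) atTop (fun n => toWeakSpace ℝ E (x n))

/-- Condition (Z). -/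
def ConditionZ (C : Set E) (T : ℕ → E → E) : Prop :=
  ∀ x : ℕ → E, (∀ n, x n ∈ C) → Bornology.IsBounded (Set.range x) →
    Tendsto (fun n => T n (x n) - x n) atTop (𝓝 0) →
    ∀ p : E, IsWeakClusterPt p x → p ∈ commonFixedPoints C T

end

/-! Let `w` be the projection of `u` onto `F`, `y n` the point before projecting onto `C`, and `f =
Ju - Jw`. Convexity of `φ(w, ·)` in the dual variable gives `φ(w, x (n+1)) ≤ (1 - α n) φ(w, S n (x
n)) + 2 α n f(y n - w)`.

For every `ε` there is a `δ` such that eventually either `S n` lowers `φ(w, x n)` by at least `δ`,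
or `f(y n - w) ≤ ε`. Otherwise some subsequence has vanishing decrease, so its displacements vanish
and its weak limits lie in `F`, where the variational inequality of `w` gives `f(p - w) ≤ 0`: a
contradiction. Since `α n → 0`, a drop of `δ` absorbs the error term, so both alternatives give the
same recursion, which forces `φ(w, x n) → 0`. No monotonicity of `φ(w, x n)` is needed.

Uniform convexity supplies the weak limits and turns `φ → 0` into norm convergence; smoothness
supplies the variational inequalities. -/

/-! ### Uniform convexity and weak compactness -/

/-- In a uniformly convex space the squared norm is uniformly convex on bounded sets. -/
theorem exists_sq_norm_midpoint_le {E : Type*} [NormedAddCommGroup E] [NormedSpace ℝ E]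
    [UniformConvexSpace E] (R : ℝ) {ε : ℝ} (hε : 0 < ε) :
    ∃ η > 0, ∀ a b : E, ‖a‖ ≤ R → ‖b‖ ≤ R → ε ≤ ‖a - b‖ →
      ‖(1 / 2 : ℝ) • (a + b)‖ ^ 2 ≤ (‖a‖ ^ 2 + ‖b‖ ^ 2) / 2 - η := by
  obtain ⟨δ, hδ, H⟩ := exists_forall_closed_ball_dist_add_le_two_sub E
    (show 0 < ε / (|R| + 1) by positivity)
  refine ⟨(δ * ε / 8) ^ 2, by positivity, ?_⟩
  have key : ∀ a b : E, ‖b‖ ≤ ‖a‖ → ‖a‖ ≤ R → ε ≤ ‖a - b‖ →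
      ‖(1 / 2 : ℝ) • (a + b)‖ ^ 2 ≤ (‖a‖ ^ 2 + ‖b‖ ^ 2) / 2 - (δ * ε / 8) ^ 2 := by
    intro a b hba haR hab
    have hρ : ε / 2 ≤ ‖a‖ := by linarith [norm_sub_le a b]
    have hpos : 0 < ‖a‖ := by linarith
    have hRle : ‖a‖ ≤ |R| + 1 := by linarith [le_abs_self R]
    have h1 := H (x := ‖a‖⁻¹ • a) (by rw [norm_smul, norm_inv, norm_norm]; field_simp; rfl)
      (y := ‖a‖⁻¹ • b) (by rw [norm_smul, norm_inv, norm_norm, inv_mul_le_one₀ hpos]; exact hba)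
      (by
        rw [← smul_sub, norm_smul, norm_inv, norm_norm, inv_mul_eq_div]
        gcongr)
    rw [← smul_add, norm_smul, norm_inv, norm_norm, inv_mul_le_iff₀ hpos] at h1
    have hm : ‖(1 / 2 : ℝ) • (a + b)‖ = ‖a + b‖ / 2 := by
      rw [norm_smul]; norm_num; ring
    rw [hm]
    have h2 : ‖a + b‖ ≤ ‖a‖ + ‖b‖ := norm_add_le a b
    have h3 : ‖a + b‖ ≤ 2 * ‖a‖ - δ * ε / 2 := by nlinarith
    have h0 := norm_nonneg (a + b)
    have hδε : 0 < δ * ε := by positivity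
    generalize δ * ε = c at *
    -- If the norms differ by `c / 4`, strict convexity of the real square suffices; otherwise `h3`
    -- puts the midpoint norm `c / 8` below the mean of the norms.
    rcases le_total (c / 4) (‖a‖ - ‖b‖) with h | h
    · nlinarith [pow_le_pow_left₀ (by positivity) h 2, pow_le_pow_left₀ h0 h2 2]
    · have h4 : ‖a + b‖ / 2 ≤ (‖a‖ + ‖b‖) / 2 - c / 8 := by linarith
      have h5 := pow_le_pow_left₀ (by positivity) h4 2
      nlinarith [sq_nonneg (‖a‖ - ‖b‖)]
  intro a b ha hb hab
  rcases le_total ‖b‖ ‖a‖ with h | h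
  · exact key a b h ha hab
  · rw [add_comm a b, add_comm (‖a‖ ^ 2)]
    exact key b a h hb (by rwa [norm_sub_rev])

/-- In a uniformly convex Banach space a directed family of nonempty bounded closed convex sets has
nonempty intersection. -/
theorem nonempty_iInter_of_directed_convex {E : Type*} [NormedAddCommGroup E] [NormedSpace ℝ E]
    [CompleteSpace E] [UniformConvexSpace E] {ι : Type*} [Nonempty ι] (K : ι → Set E) (R : ℝ)
    (hdir : Directed (· ⊇ ·) K) (hne : ∀ i, (K i).Nonempty) (hcl : ∀ i, IsClosed (K i))
    (hconv : ∀ i, Convex ℝ (K i)) (hR : ∀ i, ∀ y ∈ K i, ‖y‖ ≤ R) : (⋂ i, K i).Nonempty := by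
  -- Near-minimizers of the norm in `K i` cluster once `N i` is close to `d = ⨆ N i`, because their
  -- midpoint stays in `K i`. They therefore generate a Cauchy filter, whose limit lies in every `K
  -- i`.
  set N : ι → ℝ := fun i => sInf ((fun y => ‖y‖ ^ 2) '' K i) with hN
  have hbdd : ∀ i, BddBelow ((fun y => ‖y‖ ^ 2) '' K i) := fun i =>
    ⟨0, by rintro _ ⟨y, -, rfl⟩; positivity⟩
  have hNle : ∀ i, ∀ y ∈ K i, N i ≤ ‖y‖ ^ 2 := fun i y hy => csInf_le (hbdd i) ⟨y, hy, rfl⟩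
  have hNR : BddAbove (Set.range N) := by
    refine ⟨R ^ 2, ?_⟩
    rintro _ ⟨i, rfl⟩
    obtain ⟨y, hy⟩ := hne i
    exact (hNle i y hy).trans (pow_le_pow_left₀ (norm_nonneg _) (hR i y hy) 2)
  set d := ⨆ i, N i with hd
  have hpt : ∀ i, ∀ ε > 0, ∃ y ∈ K i, ‖y‖ ^ 2 < d + ε := by
    intro i ε hε
    obtain ⟨_, ⟨y, hy, rfl⟩, h⟩ := exists_lt_of_csInf_lt ((hne i).image _)
      (show sInf ((fun y => ‖y‖ ^ 2) '' K i) < d + ε by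
        have := le_ciSup hNR i
        simp only [hN] at this hd ⊢
        linarith)
    exact ⟨y, hy, h⟩
  have hclose : ∀ ε > 0, ∃ η > 0, ∀ i, d - η < N i → ∀ a ∈ K i, ∀ b ∈ K i,
      ‖a‖ ^ 2 < d + η → ‖b‖ ^ 2 < d + η → ‖a - b‖ < ε := by
    intro ε hε
    obtain ⟨η, hη, H⟩ := exists_sq_norm_midpoint_le (E := E) R hε
    refine ⟨η / 2, by positivity, fun i hi a ha b hb h1 h2 => ?_⟩
    by_contra! hab
    have h3 := H a b (hR i a ha) (hR i b hb) hab
    have h4 : (1 / 2 : ℝ) • (a + b) ∈ K i := by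
      rw [smul_add]
      exact hconv i ha hb (by norm_num) (by norm_num) (by norm_num)
    have h5 := hNle i _ h4
    linarith
  have hidx : ∀ ε > 0, ∃ i, d - ε < N i := fun ε hε =>
    exists_lt_of_lt_ciSup (show d - ε < ⨆ i, N i by rw [← hd]; linarith)
  let ℱ : Filter E := ⨅ p : ι × {ε : ℝ // 0 < ε}, 𝓟 {y | y ∈ K p.1 ∧ ‖y‖ ^ 2 < d + p.2}
  have hmem : ∀ i, ∀ ε > 0, {y | y ∈ K i ∧ ‖y‖ ^ 2 < d + ε} ∈ ℱ := fun i ε hε =>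
    mem_iInf_of_mem (i, ⟨ε, hε⟩) (mem_principal_self _)
  have : Nonempty {ε : ℝ // 0 < ε} := ⟨⟨1, one_pos⟩⟩
  have hneBot : ℱ.NeBot := by
    refine iInf_neBot_of_directed ?_ ?_
    · rintro ⟨i, ε⟩ ⟨j, δ⟩
      obtain ⟨k, hik, hjk⟩ := hdir i j
      refine ⟨(k, ⟨min ε δ, lt_min ε.2 δ.2⟩), ?_, ?_⟩
      · refine principal_mono.2 fun y hy => ⟨hik hy.1, hy.2.trans_le ?_⟩
        simp
      · refine principal_mono.2 fun y hy => ⟨hjk hy.1, hy.2.trans_le ?_⟩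
        simp
    · rintro ⟨i, ε⟩
      obtain ⟨y, hy⟩ := hpt i ε ε.2
      exact principal_neBot_iff.2 ⟨y, hy⟩
  have hcauchy : Cauchy ℱ := by
    refine Metric.cauchy_iff.2 ⟨hneBot, fun ε hε => ?_⟩
    obtain ⟨η, hη, H⟩ := hclose ε hε
    obtain ⟨i, hi⟩ := hidx η hη
    refine ⟨_, hmem i η hη, fun a ha b hb => ?_⟩
    rw [dist_eq_norm]
    exact H i hi a ha.1 b hb.1 ha.2 hb.2
  obtain ⟨p, hp⟩ := CompleteSpace.complete hcauchy
  refine ⟨p, Set.mem_iInter.2 fun i => (hcl i).mem_of_tendsto (f := id) (b := ℱ) hp ?_⟩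
  exact mem_of_superset (hmem i 1 one_pos) fun y hy => hy.1

/-- In a uniformly convex Banach space a bounded family converges weakly along every ultrafilter. -/
theorem exists_forall_tendsto_of_ultrafilter {E : Type*} [NormedAddCommGroup E] [NormedSpace ℝ E]
    [CompleteSpace E] [UniformConvexSpace E] {ι : Type*} (U : Ultrafilter ι) (x : ι → E) (R : ℝ)
    (hx : ∀ i, ‖x i‖ ≤ R) : ∃ p : E, ∀ f : StrongDual ℝ E, Tendsto (fun i => f (x i)) U (𝓝 (f p)) := by
  have : Nonempty {A // A ∈ U} := ⟨⟨Set.univ, Filter.univ_mem⟩⟩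
  -- A point in the closed convex hull of `x '' A` for all `A ∈ U` is the weak limit: a closed
  -- half-space missing `p` cannot contain `x i` for `U`-many `i`.
  obtain ⟨p, hp⟩ := nonempty_iInter_of_directed_convex
    (fun A : {A // A ∈ U} => closure (convexHull ℝ (x '' A))) R
    (by
      rintro ⟨A, hA⟩ ⟨B, hB⟩
      refine ⟨⟨A ∩ B, Filter.inter_mem hA hB⟩, ?_, ?_⟩
      · exact closure_mono (convexHull_mono (Set.image_mono Set.inter_subset_left))
      · exact closure_mono (convexHull_mono (Set.image_mono Set.inter_subset_right)))
    (fun A => ((U.nonempty_of_mem A.2).image x).convexHull.closure)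
    (fun A => isClosed_closure) (fun A => (convex_convexHull ℝ _).closure)
    (by
      intro A y hy
      have : closure (convexHull ℝ (x '' A)) ⊆ Metric.closedBall 0 R := by
        refine closure_minimal (convexHull_min ?_ (convex_closedBall _ _)) Metric.isClosed_closedBall
        rintro _ ⟨i, -, rfl⟩
        simpa using hx i
      simpa using this hy)
  refine ⟨p, fun f => ?_⟩
  have hp' : ∀ A ∈ U, p ∈ closure (convexHull ℝ (x '' A)) := fun A hA =>
    Set.mem_iInter.1 hp ⟨A, hA⟩
  rw [tendsto_order]
  constructor
  · intro c hc
    rcases U.mem_or_compl_mem {i | c < f (x i)} with h | h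
    · exact h
    · exfalso
      have : closure (convexHull ℝ (x '' {i | c < f (x i)}ᶜ)) ⊆ {y | f y ≤ c} := by
        refine closure_minimal (convexHull_min ?_ (convex_halfSpace_le f.isLinear c))
          (isClosed_le f.continuous continuous_const)
        rintro _ ⟨i, hi, rfl⟩
        simpa using hi
      exact absurd (this (hp' _ h)) (not_le.2 hc)
  · intro c hc
    rcases U.mem_or_compl_mem {i | f (x i) < c} with h | h
    · exact h
    · exfalso
      have : closure (convexHull ℝ (x '' {i | f (x i) < c}ᶜ)) ⊆ {y | c ≤ f y} := by
        refine closure_minimal (convexHull_min ?_ (convex_halfSpace_ge f.isLinear c))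
          (isClosed_le continuous_const f.continuous)
        rintro _ ⟨i, hi, rfl⟩
        simpa using hi
      exact absurd (this (hp' _ h)) (not_le.2 hc)

/-! ### Duality mapping and Lyapunov functional -/

section Duality
variable {E : Type*} [NormedAddCommGroup E] [NormedSpace ℝ E]

theorem dualityMap_apply_self (x : E) : dualityMap x x = ‖x‖ ^ 2 :=
  (dualitySet_nonempty x).some_mem.1

theorem norm_dualityMap (x : E) : ‖dualityMap x‖ = ‖x‖ :=
  (pow_left_inj₀ (norm_nonneg _) (norm_nonneg _) two_ne_zero).1 (dualitySet_nonempty x).some_mem.2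

theorem dualityMap_apply_le (x y : E) : dualityMap x y ≤ ‖x‖ * ‖y‖ := by
  rw [← norm_dualityMap x]
  exact (le_abs_self _).trans ((dualityMap x).le_opNorm y)

theorem sq_norm_sub_norm_le_lyapunov (x y : E) : (‖x‖ - ‖y‖) ^ 2 ≤ lyapunov x y := by
  have := dualityMap_apply_le y x
  simp only [lyapunov]
  nlinarith

theorem lyapunov_nonneg (x y : E) : 0 ≤ lyapunov x y :=
  (sq_nonneg _).trans (sq_norm_sub_norm_le_lyapunov x y)

theorem lyapunov_self (x : E) : lyapunov x x = 0 := by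
  rw [lyapunov, dualityMap_apply_self]; ring

theorem norm_le_of_lyapunov_le {p y : E} {M : ℝ} (h : lyapunov p y ≤ M) : ‖y‖ ≤ ‖p‖ + √M := by
  have h1 := Real.abs_le_sqrt ((sq_norm_sub_norm_le_lyapunov p y).trans h)
  linarith [(abs_le.1 h1).1]

theorem lyapunov_three_point (p z y : E) :
    lyapunov p y = lyapunov p z + lyapunov z y + 2 * (dualityMap z (p - z) - dualityMap y (p - z)) := by
  simp only [lyapunov, map_sub, dualityMap_apply_self]
  ring

theorem lyapunov_add_lyapunov_comm (a b : E) :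
    lyapunov a b + lyapunov b a = 2 * (dualityMap a - dualityMap b) (a - b) := by
  simp only [lyapunov, map_sub, sub_apply, dualityMap_apply_self]
  ring

/-- Uniform version of: `φ(a, b) = 0` forces `a = b`. -/
theorem exists_forall_lyapunov_lt_norm_sub_lt [UniformConvexSpace E] (R : ℝ) {ε : ℝ} (hε : 0 < ε) :
    ∃ η > 0, ∀ a b : E, ‖a‖ ≤ R → ‖b‖ ≤ R → lyapunov a b < η → ‖a - b‖ < ε := by
  obtain ⟨η, hη, H⟩ := exists_sq_norm_midpoint_le (E := E) R hε
  refine ⟨2 * η, by positivity, fun a b ha hb h => ?_⟩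
  by_contra! hab
  have h1 := H a b ha hb hab
  -- Nonnegativity at the midpoint `m` reads `⟨a, Jb⟩ ≤ ‖m‖ ^ 2`, so the midpoint gap `η` yields
  -- `φ(a, b) ≥ 2 * η`.
  have h2 := lyapunov_nonneg ((1 / 2 : ℝ) • (a + b)) b
  simp only [lyapunov, map_smul, map_add, dualityMap_apply_self, smul_eq_mul] at h h2
  linarith

theorem tendsto_sub_of_tendsto_lyapunov [UniformConvexSpace E] {ι : Type*} {l : Filter ι}
    {a b : ι → E} {R : ℝ} (ha : ∀ i, ‖a i‖ ≤ R) (hb : ∀ i, ‖b i‖ ≤ R)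
    (h : Tendsto (fun i => lyapunov (a i) (b i)) l (𝓝 0)) :
    Tendsto (fun i => a i - b i) l (𝓝 0) := by
  rw [Metric.tendsto_nhds]
  intro ε hε
  obtain ⟨η, hη, H⟩ := exists_forall_lyapunov_lt_norm_sub_lt (E := E) R hε
  filter_upwards [h.eventually (gt_mem_nhds hη)] with i hi
  rw [dist_zero_right]
  exact H _ _ (ha i) (hb i) hi

theorem eq_of_lyapunov_le_zero [UniformConvexSpace E] {a b : E} (h : lyapunov a b ≤ 0) : a = b := by
  by_contra hab
  obtain ⟨η, hη, H⟩ := exists_forall_lyapunov_lt_norm_sub_lt (E := E) (max ‖a‖ ‖b‖)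
    (norm_pos_iff.2 (sub_ne_zero.2 hab))
  exact lt_irrefl _ (H a b (le_max_left _ _) (le_max_right _ _) (h.trans_lt hη))

/-- In a smooth space the squared norm has directional derivative `2 ⟨y, J x⟩`. -/
theorem IsSmoothSpace.hasDerivAt_sq_norm (hE : IsSmoothSpace E) (x y : E) :
    HasDerivAt (fun t : ℝ => ‖x + t • y‖ ^ 2) (2 * dualityMap x y) 0 := by
  have hder : ∃ l, HasDerivAt (fun t : ℝ => ‖x + t • y‖ ^ 2) l 0 := by
    rcases eq_or_ne x 0 with rfl | hx
    · refine ⟨0, ?_⟩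
      have h : (fun t : ℝ => ‖(0 : E) + t • y‖ ^ 2) = fun t => t ^ 2 * ‖y‖ ^ 2 := by
        ext t; rw [zero_add, norm_smul, mul_pow, Real.norm_eq_abs, sq_abs]
      rw [h]
      simpa using ((hasDerivAt_pow 2 (0 : ℝ)).mul_const (‖y‖ ^ 2))
    rcases eq_or_ne y 0 with rfl | hy
    · exact ⟨0, by simpa using hasDerivAt_const (0 : ℝ) (‖x‖ ^ 2)⟩
    have hx' : 0 < ‖x‖ := norm_pos_iff.2 hx
    have hy' : 0 < ‖y‖ := norm_pos_iff.2 hy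
    obtain ⟨l, hl⟩ := hE (‖x‖⁻¹ • x) (‖y‖⁻¹ • y)
      (by rw [norm_smul, norm_inv, norm_norm, inv_mul_cancel₀ hx'.ne'])
      (by rw [norm_smul, norm_inv, norm_norm, inv_mul_cancel₀ hy'.ne'])
    have h1 : HasDerivAt (fun t : ℝ => ‖‖x‖⁻¹ • x + t • (‖y‖⁻¹ • y)‖) l 0 := by
      rw [hasDerivAt_iff_tendsto_slope]
      refine hl.congr fun t => ?_
      simp [slope_def_field]
    have h2 : HasDerivAt (fun t : ℝ => (‖x‖⁻¹ * ‖y‖) * t) (‖x‖⁻¹ * ‖y‖) 0 := by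
      simpa using (hasDerivAt_id (0 : ℝ)).const_mul (‖x‖⁻¹ * ‖y‖)
    have h3 := (HasDerivAt.comp (0 : ℝ) (h₂ := fun t : ℝ => ‖‖x‖⁻¹ • x + t • (‖y‖⁻¹ • y)‖)
      (by simpa using h1) h2).const_mul ‖x‖
    refine ⟨_, (h3.congr_of_eventuallyEq (Eventually.of_forall fun t => ?_)).pow 2⟩
    simp only [Function.comp]
    have h4 : ‖x‖⁻¹ • x + (‖x‖⁻¹ * ‖y‖ * t) • ‖y‖⁻¹ • y = ‖x‖⁻¹ • (x + t • y) := by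
      rw [smul_smul, smul_add, smul_smul]
      congr 2
      field_simp
    rw [h4, norm_smul, norm_inv, norm_norm, mul_inv_cancel_left₀ hx'.ne']
  obtain ⟨l, hl⟩ := hder
  -- `φ(x + t y, x) ≥ 0` says that `Jx` supports the squared norm at `x`, which identifies the
  -- derivative.
  have hmin : IsLocalMin (fun t : ℝ => ‖x + t • y‖ ^ 2 - 2 * dualityMap x y * t) 0 := by
    refine Eventually.of_forall fun t => ?_
    have := lyapunov_nonneg (x + t • y) x
    simp only [lyapunov, map_add, map_smul, dualityMap_apply_self, smul_eq_mul] at this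
    simp only [zero_smul, add_zero, mul_zero, sub_zero]
    linarith
  have hd : HasDerivAt (fun t : ℝ => ‖x + t • y‖ ^ 2 - 2 * dualityMap x y * t)
      (l - 2 * dualityMap x y) 0 := by
    simpa only [mul_one, id] using
      hl.fun_sub ((hasDerivAt_id (0 : ℝ)).const_mul (2 * dualityMap x y))
  rwa [← sub_eq_zero.1 (hmin.hasDerivAt_eq_zero hd)]

/-! ### Generalized projections and surjectivity of `J` -/

/-- The functional is convex, continuous and coercive, so its near-minimal sublevel sets in `D` are
nested, bounded, closed and convex, hence share a point. -/
theorem exists_minimizer_sq_norm_sub [CompleteSpace E] [UniformConvexSpace E]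
    {D : Set E} (hne : D.Nonempty) (hcl : IsClosed D) (hconv : Convex ℝ D) (f : StrongDual ℝ E) :
    ∃ z ∈ D, ∀ y ∈ D, ‖z‖ ^ 2 - 2 * f z ≤ ‖y‖ ^ 2 - 2 * f y := by
  set h : E → ℝ := fun y => ‖y‖ ^ 2 - 2 * f y with hh
  have hcont : Continuous h := by fun_prop
  have hconvex : ConvexOn ℝ Set.univ h := by
    have h1 : ConvexOn ℝ Set.univ fun y : E => ‖y‖ ^ 2 :=
      (convexOn_norm convex_univ).pow (fun _ _ => norm_nonneg _) 2
    have h2 : ConcaveOn ℝ Set.univ fun y : E => 2 * f y :=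
      ((2 : ℝ) • f).toLinearMap.concaveOn convex_univ
    exact h1.sub h2
  have hbelow : ∀ y, (‖y‖ - ‖f‖) ^ 2 - ‖f‖ ^ 2 ≤ h y := fun y => by
    have := (le_abs_self _).trans (f.le_opNorm y)
    simp only [hh]
    nlinarith
  have hbdd : BddBelow (h '' D) := by
    refine ⟨-‖f‖ ^ 2, ?_⟩
    rintro _ ⟨y, -, rfl⟩
    nlinarith [hbelow y]
  set m := sInf (h '' D) with hm
  have : Nonempty {ε : ℝ // 0 < ε ∧ ε ≤ 1} := ⟨⟨1, one_pos, le_rfl⟩⟩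
  obtain ⟨z, hz⟩ := nonempty_iInter_of_directed_convex
    (fun ε : {ε : ℝ // 0 < ε ∧ ε ≤ 1} => D ∩ {y | h y ≤ m + ε}) (‖f‖ + √(m + 1 + ‖f‖ ^ 2))
    (by
      intro a b
      refine ⟨⟨min a b, lt_min a.2.1 b.2.1, (min_le_left _ _).trans a.2.2⟩, ?_, ?_⟩
      · exact fun y hy => ⟨hy.1, (Set.mem_ofPred.1 hy.2).trans (by simp)⟩
      · exact fun y hy => ⟨hy.1, (Set.mem_ofPred.1 hy.2).trans (by simp)⟩)
    (by
      intro a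
      obtain ⟨_, ⟨y, hy, rfl⟩, hlt⟩ := exists_lt_of_csInf_lt (hne.image h)
        (show sInf (h '' D) < m + a by linarith [a.2.1])
      exact ⟨y, hy, hlt.le⟩)
    (fun a => hcl.inter (isClosed_le hcont continuous_const))
    (fun a => hconv.inter (by simpa using hconvex.convex_le (m + a)))
    (by
      intro a y hy
      have h1 : (‖y‖ - ‖f‖) ^ 2 ≤ m + 1 + ‖f‖ ^ 2 := by
        have h2 : h y ≤ m + a := hy.2
        linarith [hbelow y, a.2.2]
      linarith [(abs_le.1 (Real.abs_le_sqrt h1)).2])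
  have hz' := Set.mem_iInter.1 hz
  refine ⟨z, (hz' ⟨1, one_pos, le_rfl⟩).1, fun y hy => ?_⟩
  have h1 : h z ≤ m := by
    refine le_of_forall_pos_le_add fun ε hε => ?_
    have h2 : h z ≤ m + min ε 1 := (hz' ⟨min ε 1, lt_min hε one_pos, min_le_right _ _⟩).2
    linarith [min_le_left ε 1]
  exact h1.trans (csInf_le hbdd ⟨y, hy, rfl⟩)

/-- First-order optimality: the right derivative at `z` along the segment towards `y` is
nonnegative. -/
theorem IsSmoothSpace.le_of_minimizer (hE : IsSmoothSpace E) {D : Set E} (hconv : Convex ℝ D)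
    {f : StrongDual ℝ E} {z : E} (hz : z ∈ D)
    (hmin : ∀ y ∈ D, ‖z‖ ^ 2 - 2 * f z ≤ ‖y‖ ^ 2 - 2 * f y) {y : E} (hy : y ∈ D) :
    f (y - z) ≤ dualityMap z (y - z) := by
  have hd : HasDerivAt (fun t : ℝ => ‖z + t • (y - z)‖ ^ 2 - 2 * f (y - z) * t)
      (2 * dualityMap z (y - z) - 2 * f (y - z)) 0 := by
    simpa only [mul_one, id] using (hE.hasDerivAt_sq_norm z (y - z)).fun_sub
      ((hasDerivAt_id (0 : ℝ)).const_mul (2 * f (y - z)))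
  have h1 := (hasDerivWithinAt_iff_tendsto_slope' (s := Set.Ioi (0 : ℝ)) (by simp)).1
    hd.hasDerivWithinAt
  have h2 : 0 ≤ 2 * dualityMap z (y - z) - 2 * f (y - z) := by
    refine ge_of_tendsto h1 ?_
    filter_upwards [Ioo_mem_nhdsGT (zero_lt_one' ℝ)] with t ht
    have h3 := hmin (z + t • (y - z)) (by
      have := hconv hz hy (sub_nonneg.2 ht.2.le) ht.1.le (by ring)
      convert this using 1
      module)
    simp only [slope_def_field, sub_zero, zero_smul, add_zero, mul_zero]
    refine div_nonneg ?_ ht.1.le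
    simp only [map_add, map_smul, smul_eq_mul] at h3
    linarith
  linarith

/-- Minimizing `‖y‖ ^ 2 - 2 * f y` over the whole space, the optimality condition in opposite
directions becomes the equation `Jz = f`. -/
theorem IsSmoothSpace.dualityMap_surjective [CompleteSpace E] [UniformConvexSpace E]
    (hE : IsSmoothSpace E) : Function.Surjective (dualityMap : E → StrongDual ℝ E) := by
  intro f
  obtain ⟨z, hz, hmin⟩ := exists_minimizer_sq_norm_sub Set.univ_nonempty isClosed_univ
    (convex_univ (𝕜 := ℝ) (E := E)) f
  refine ⟨z, ContinuousLinearMap.ext fun y => le_antisymm ?_ ?_⟩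
  · have := hE.le_of_minimizer convex_univ hz hmin (Set.mem_univ (z - y))
    simp only [map_sub] at this
    linarith
  · have := hE.le_of_minimizer convex_univ hz hmin (Set.mem_univ (z + y))
    simp only [add_sub_cancel_left] at this
    exact this

theorem IsSmoothSpace.dualityMap_dualityInv [CompleteSpace E] [UniformConvexSpace E]
    (hE : IsSmoothSpace E) (f : StrongDual ℝ E) : dualityMap (dualityInv f) = f :=
  Function.rightInverse_invFun hE.dualityMap_surjective f

theorem exists_isGeneralizedProjection [CompleteSpace E] [UniformConvexSpace E]
    {D : Set E} (hne : D.Nonempty) (hcl : IsClosed D) (hconv : Convex ℝ D) (x : E) :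
    ∃ z, IsGeneralizedProjection D x z := by
  obtain ⟨z, hz, hmin⟩ := exists_minimizer_sq_norm_sub hne hcl hconv (dualityMap x)
  exact ⟨z, hz, fun y hy => by simp only [lyapunov]; linarith [hmin y hy]⟩

theorem isGeneralizedProjection_generalizedProjection [CompleteSpace E] [UniformConvexSpace E]
    {D : Set E} (hne : D.Nonempty) (hcl : IsClosed D) (hconv : Convex ℝ D) (x : E) :
    IsGeneralizedProjection D x (generalizedProjection D x) := by
  have h := exists_isGeneralizedProjection hne hcl hconv x
  rw [generalizedProjection, dif_pos h]
  exact h.choose_spec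

theorem IsGeneralizedProjection.dualityMap_le (hE : IsSmoothSpace E) {D : Set E}
    (hconv : Convex ℝ D) {x z : E} (hz : IsGeneralizedProjection D x z) {y : E} (hy : y ∈ D) :
    dualityMap x (y - z) ≤ dualityMap z (y - z) :=
  hE.le_of_minimizer hconv hz.1
    (fun v hv => by have := hz.2 v hv; simp only [lyapunov] at this; linarith) hy

theorem IsGeneralizedProjection.lyapunov_add_le (hE : IsSmoothSpace E) {D : Set E}
    (hconv : Convex ℝ D) {x z : E} (hz : IsGeneralizedProjection D x z) {y : E} (hy : y ∈ D) :
    lyapunov y z + lyapunov z x ≤ lyapunov y x := by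
  have := hz.dualityMap_le hE hconv hy
  rw [lyapunov_three_point y z x]
  linarith

theorem IsGeneralizedProjection.eq [UniformConvexSpace E] (hE : IsSmoothSpace E) {D : Set E}
    (hconv : Convex ℝ D) {x z z' : E} (hz : IsGeneralizedProjection D x z)
    (hz' : IsGeneralizedProjection D x z') : z' = z := by
  have h1 := hz.lyapunov_add_le hE hconv hz'.1
  have h2 := hz'.2 z hz.1
  exact eq_of_lyapunov_le_zero (by linarith)

/-! ### Fixed point sets of mappings of type (r) -/

theorem IsTypeR.mem_fixedPointsOn_iff [UniformConvexSpace E] {C : Set E} {T : E → E}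
    (hT : IsTypeR C T) {p : E} :
    p ∈ fixedPointsOn C T ↔ p ∈ C ∧ ∀ x ∈ C, lyapunov p (T x) ≤ lyapunov p x := by
  refine ⟨fun hp => ⟨hp.1, fun x hx => hT.2 x hx p hp⟩, fun hp => ⟨hp.1, ?_⟩⟩
  have := hp.2 p hp.1
  rw [lyapunov_self] at this
  exact (eq_of_lyapunov_le_zero this).symm

/-- The term `‖p‖ ^ 2` cancels, leaving a closed half-space; fixed point sets are thus closed and
convex. -/
theorem setOf_lyapunov_le_eq (a b : E) : {p : E | lyapunov p a ≤ lyapunov p b} =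
    {p | (dualityMap b - dualityMap a) p ≤ (‖b‖ ^ 2 - ‖a‖ ^ 2) / 2} := by
  ext p
  simp only [lyapunov, Set.mem_ofPred_eq, sub_apply]
  constructor <;> intro h <;> linarith

theorem IsTypeR.fixedPointsOn_eq [UniformConvexSpace E] {C : Set E} {T : E → E}
    (hT : IsTypeR C T) :
    fixedPointsOn C T = C ∩ ⋂ x ∈ C, {p | lyapunov p (T x) ≤ lyapunov p x} := by
  ext p
  simp [hT.mem_fixedPointsOn_iff]

theorem IsTypeR.isClosed_fixedPointsOn [UniformConvexSpace E] {C : Set E} {T : E → E}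
    (hT : IsTypeR C T) (hC : IsClosed C) : IsClosed (fixedPointsOn C T) := by
  rw [hT.fixedPointsOn_eq]
  refine hC.inter (isClosed_biInter fun x _ => ?_)
  rw [setOf_lyapunov_le_eq]
  exact isClosed_le (ContinuousLinearMap.continuous _) continuous_const

theorem IsTypeR.convex_fixedPointsOn [UniformConvexSpace E] {C : Set E} {T : E → E}
    (hT : IsTypeR C T) (hC : Convex ℝ C) : Convex ℝ (fixedPointsOn C T) := by
  rw [hT.fixedPointsOn_eq]
  refine hC.inter (convex_iInter₂ fun x _ => ?_)
  rw [setOf_lyapunov_le_eq]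
  exact convex_halfSpace_le (dualityMap x - dualityMap (T x)).isLinear _

/-- The Lyapunov functional is convex in the dual variable, with an error term when the base points
are not those of the combination. -/
theorem lyapunov_le_of_dualityMap_eq {y u v : E} {a : ℝ} (ha : a ∈ Set.Ioc (0 : ℝ) 1)
    (h : dualityMap y = a • dualityMap u + (1 - a) • dualityMap v) (p q : E) :
    lyapunov p y ≤ a * lyapunov p q + (1 - a) * lyapunov p v
      + 2 * a * (dualityMap u - dualityMap q) (y - p) := by
  -- Average the two identities with weights `a` and `1 - a`, and drop `φ(y, q)` and `φ(y, v)`.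
  have h1 := lyapunov_three_point p y q
  have h2 := lyapunov_three_point p y v
  have h3 := mul_nonneg ha.1.le (lyapunov_nonneg y q)
  have h4 := mul_nonneg (sub_nonneg.2 ha.2) (lyapunov_nonneg y v)
  rw [h1, h2, ← neg_sub y p]
  simp only [h, add_apply, sub_apply,
    smul_apply, smul_eq_mul, map_neg]
  nlinarith

end Duality

/-! ### A recursive inequality for real sequences -/

/-- Subtracting the error level leaves a factor `1 - α n ≤ exp (-α n)` per step, and the product of
these tends to zero as `∑ α n` diverges. -/
theorem tendsto_zero_of_eventually_le_one_sub_mul_add {a α : ℕ → ℝ} (ha : ∀ n, 0 ≤ a n)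
    (hα : ∀ n, α n ∈ Set.Ioc (0 : ℝ) 1)
    (hsum : Tendsto (fun N => ∑ n ∈ Finset.range N, α n) atTop atTop)
    (h : ∀ ε > 0, ∀ᶠ n in atTop, a (n + 1) ≤ (1 - α n) * a n + ε * α n) :
    Tendsto a atTop (𝓝 0) := by
  rw [tendsto_order]
  refine ⟨fun c hc => Eventually.of_forall fun n => hc.trans_le (ha n), fun ε hε => ?_⟩
  obtain ⟨N, hN⟩ := eventually_atTop.1 (h (ε / 2) (by positivity))
  set s : ℕ → ℝ := fun n => ∑ i ∈ Finset.range n, α i with hs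
  set M := |a N - ε / 2| * Real.exp (s N) with hM
  have hb : ∀ n, N ≤ n → a n - ε / 2 ≤ Real.exp (-s n) * M := by
    intro n hn
    induction n, hn using Nat.le_induction with
    | base =>
      rw [hM, mul_left_comm, ← Real.exp_add, neg_add_cancel, Real.exp_zero, mul_one]
      exact le_abs_self _
    | succ n hn ih =>
      have h1 : Real.exp (-s (n + 1)) = Real.exp (-α n) * Real.exp (-s n) := by
        rw [← Real.exp_add, hs]
        simp only [Finset.sum_range_succ]
        ring_nf
      have h2 : 1 - α n ≤ Real.exp (-α n) := Real.one_sub_le_exp_neg _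
      have h3 : 0 ≤ Real.exp (-s n) * M := by positivity
      calc a (n + 1) - ε / 2 ≤ (1 - α n) * (a n - ε / 2) := by linarith [hN n hn]
        _ ≤ (1 - α n) * (Real.exp (-s n) * M) :=
            mul_le_mul_of_nonneg_left ih (sub_nonneg.2 (hα n).2)
        _ ≤ Real.exp (-α n) * (Real.exp (-s n) * M) := mul_le_mul_of_nonneg_right h2 h3
        _ = Real.exp (-s (n + 1)) * M := by rw [h1, mul_assoc]
  have hlim : Tendsto (fun n => Real.exp (-s n) * M) atTop (𝓝 0) := by
    simpa using (Real.tendsto_exp_neg_atTop_nhds_zero.comp hsum).mul_const M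
  filter_upwards [hlim.eventually (gt_mem_nhds (half_pos hε)), eventually_ge_atTop N] with n h1 h2
  linarith [hb n h2]

/-! ### Common fixed points and weak limits -/

section FixedPoints
variable {E : Type*} [NormedAddCommGroup E] [NormedSpace ℝ E] [UniformConvexSpace E]

theorem isClosed_commonFixedPoints {C : Set E} {S : ℕ → E → E} (hS : ∀ n, IsTypeR C (S n))
    (hC : IsClosed C) : IsClosed (commonFixedPoints C S) :=
  isClosed_iInter fun n => (hS n).isClosed_fixedPointsOn hC

theorem convex_commonFixedPoints {C : Set E} {S : ℕ → E → E} (hS : ∀ n, IsTypeR C (S n))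
    (hC : Convex ℝ C) : Convex ℝ (commonFixedPoints C S) :=
  convex_iInter fun n => (hS n).convex_fixedPointsOn hC

/-- If the values `φ(w, zₙ) - φ(w, Sₙ zₙ)` vanish along a subsequence of a bounded sequence, then so
do the displacements `Sₙ zₙ - zₙ`, and every weak limit along that subsequence is a common fixed
point. -/
theorem IsStronglyRelativelyNonexpansiveSeq.tendsto_and_mem_of_ultrafilter {C : Set E}
    {S : ℕ → E → E} (hS : IsStronglyRelativelyNonexpansiveSeq C S) (hZ : ConditionZ C S) {w : E}
    (hw : w ∈ commonFixedPoints C S) {x : ℕ → E} (hxC : ∀ n, x n ∈ C) {M : ℝ}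
    (hM : ∀ n, lyapunov w (x n) ≤ M) {τ : ℕ → ℕ} (hτ : StrictMono τ)
    (hdec : ∀ k, lyapunov w (x (τ k)) - lyapunov w (S (τ k) (x (τ k))) < 1 / ((k : ℝ) + 1))
    {U : Ultrafilter ℕ} (hU : (U : Filter ℕ) ≤ map τ atTop) :
    Tendsto (fun n => S n (x n) - x n) U (𝓝 0) ∧
      ∀ p, (∀ f : StrongDual ℝ E, Tendsto (fun n => f (x n)) U (𝓝 (f p))) →
        p ∈ commonFixedPoints C S := by
  classical
  have hwn : ∀ n, w ∈ fixedPointsOn C (S n) := Set.mem_iInter.1 hw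
  have hrange : Set.range τ ∈ (U : Filter ℕ) := hU (range_mem_map)
  have hUtop : (U : Filter ℕ) ≤ atTop := hU.trans hτ.tendsto_atTop
  -- Both hypotheses concern full sequences, so the gaps of the subsequence are filled with `w`,
  -- which every `S n` fixes.
  set z : ℕ → E := fun n => if n ∈ Set.range τ then x n else w with hz
  have hzx : ∀ n ∈ Set.range τ, z n = x n := fun n hn => if_pos hn
  have hzw : ∀ n, n ∉ Set.range τ → z n = w := fun n hn => if_neg hn
  have hzC : ∀ n, z n ∈ C := fun n => by
    by_cases h : n ∈ Set.range τ
    · rw [hzx n h]; exact hxC n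
    · rw [hzw n h]; exact (hwn n).1
  have hM0 : 0 ≤ M := (lyapunov_nonneg _ _).trans (hM 0)
  have hzM : ∀ n, lyapunov w (z n) ≤ M := fun n => by
    by_cases h : n ∈ Set.range τ
    · rw [hzx n h]; exact hM n
    · rwa [hzw n h, lyapunov_self]
  have hSle : ∀ n, lyapunov w (S n (z n)) ≤ lyapunov w (z n) := fun n =>
    (hS.1 n).2 _ (hzC n) w (hwn n)
  have hzR : ∀ n, ‖z n‖ ≤ ‖w‖ + √M := fun n => norm_le_of_lyapunov_le (hzM n)
  have hSR : ∀ n, ‖S n (z n)‖ ≤ ‖w‖ + √M := fun n =>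
    norm_le_of_lyapunov_le ((hSle n).trans (hzM n))
  have hzb : Bornology.IsBounded (Set.range z) :=
    isBounded_iff_forall_norm_le.2 ⟨_, by rintro _ ⟨n, rfl⟩; exact hzR n⟩
  have hlim : Tendsto (fun n => lyapunov w (z n) - lyapunov w (S n (z n))) atTop (𝓝 0) := by
    rw [tendsto_order]
    refine ⟨fun c hc => Eventually.of_forall fun n => by linarith [hSle n], fun c hc => ?_⟩
    obtain ⟨K, hK⟩ := exists_nat_one_div_lt hc
    filter_upwards [eventually_ge_atTop (τ K)] with n hn
    by_cases h : n ∈ Set.range τ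
    · obtain ⟨k, rfl⟩ := h
      rw [hzx _ ⟨k, rfl⟩]
      have hKk : (K : ℝ) ≤ k := by exact_mod_cast hτ.le_iff_le.1 hn
      refine (hdec k).trans_le (le_trans ?_ hK.le)
      gcongr
    · rw [hzw n h, (hwn n).2, sub_self]
      exact hc
  have hdisp : Tendsto (fun n => S n (z n) - z n) atTop (𝓝 0) :=
    tendsto_sub_of_tendsto_lyapunov hSR hzR (hS.2 z hzC hzb ⟨w, hw, hlim⟩)
  constructor
  · refine (hdisp.mono_left hUtop).congr' ?_
    filter_upwards [hrange] with n hn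
    rw [hzx n hn]
  · intro p hp
    refine hZ z hzC hzb hdisp p ?_
    have h1 : Tendsto (fun n => toWeakSpace ℝ E (z n)) U (𝓝 (toWeakSpace ℝ E p)) := by
      have hinj : Function.Injective (topDualPairing ℝ E).flip := fun a b hab =>
        (SeparatingDual.eq_iff_forall_dual_eq (R := ℝ)).2 fun f => DFunLike.congr_fun hab f
      refine (WeakBilin.tendsto_iff_forall_eval_tendsto (topDualPairing ℝ E).flip hinj).2 ?_
      intro f
      refine (hp f).congr' ?_
      filter_upwards [hrange] with n hn
      rw [hzx n hn]
      rfl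
    exact h1.mapClusterPt.mono hUtop

end FixedPoints

/-! ### Strong convergence of the iteration -/

theorem theorem4p1 {E : Type*} [NormedAddCommGroup E] [NormedSpace ℝ E] [CompleteSpace E]
    [UniformConvexSpace E] (hE : IsSmoothSpace E)
    (C : Set E) (hCne : C.Nonempty) (hCclosed : IsClosed C) (hCconv : Convex ℝ C)
    (S : ℕ → E → E) (hF : (commonFixedPoints C S).Nonempty)
    (hS : IsStronglyRelativelyNonexpansiveSeq C S) (hZ : ConditionZ C S)
    (α : ℕ → ℝ) (hα_mem : ∀ n, α n ∈ Set.Ioc (0 : ℝ) 1) (hα_lim : Tendsto α atTop (𝓝 0))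
    (hα_sum : Tendsto (fun N => ∑ n ∈ Finset.range N, α n) atTop atTop)
    (u : E) (x : ℕ → E) (hx0 : x 0 ∈ C)
    (hx : ∀ n, x (n + 1) = generalizedProjection C
      (dualityInv (α n • dualityMap u + (1 - α n) • dualityMap (S n (x n))))) :
    (∃! w, IsGeneralizedProjection (commonFixedPoints C S) u w) ∧
      Tendsto x atTop (𝓝 (generalizedProjection (commonFixedPoints C S) u)) := by
  have hFconv := convex_commonFixedPoints hS.1 hCconv
  have hwproj := isGeneralizedProjection_generalizedProjection hF
    (isClosed_commonFixedPoints hS.1 hCclosed) hFconv u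
  set w := generalizedProjection (commonFixedPoints C S) u
  refine ⟨⟨w, hwproj, fun v hv => hwproj.eq hE hFconv hv⟩, ?_⟩
  have hwn : ∀ n, w ∈ fixedPointsOn C (S n) := Set.mem_iInter.1 hwproj.1
  have hwC : w ∈ C := (hwn 0).1
  set y : ℕ → E := fun n =>
    dualityInv (α n • dualityMap u + (1 - α n) • dualityMap (S n (x n))) with hy
  have hJy : ∀ n, dualityMap (y n) = α n • dualityMap u + (1 - α n) • dualityMap (S n (x n)) :=
    fun n => hE.dualityMap_dualityInv _
  have hproj : ∀ n, IsGeneralizedProjection C (y n) (x (n + 1)) := fun n => by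
    rw [hx n]
    exact isGeneralizedProjection_generalizedProjection hCne hCclosed hCconv _
  have hxC : ∀ n, x n ∈ C := by
    rintro (_ | n)
    exacts [hx0, (hproj n).1]
  have hSle : ∀ n, lyapunov w (S n (x n)) ≤ lyapunov w (x n) := fun n =>
    (hS.1 n).2 _ (hxC n) w (hwn n)
  have hxy : ∀ n, lyapunov w (x (n + 1)) ≤ lyapunov w (y n) := fun n => by
    linarith [(hproj n).lyapunov_add_le hE hCconv hwC, lyapunov_nonneg (x (n + 1)) (y n)]
  -- boundedness of the three sequences
  set M := max (lyapunov w u) (lyapunov w (x 0)) with hM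
  have hyM' : ∀ n, lyapunov w (x n) ≤ M → lyapunov w (y n) ≤ M := fun n hn => by
    -- With `q = u` the error term vanishes; `hrec` takes `q = w` instead, so that `φ(w, w) = 0`.
    have h1 := lyapunov_le_of_dualityMap_eq (hα_mem n) (hJy n) w u
    rw [sub_self, zero_apply, mul_zero, add_zero] at h1
    have h2 := mul_le_mul_of_nonneg_left (le_max_left (lyapunov w u) (lyapunov w (x 0)))
      (hα_mem n).1.le
    have h3 := mul_le_mul_of_nonneg_left ((hSle n).trans hn) (sub_nonneg.2 (hα_mem n).2)
    rw [← hM] at h2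
    linarith
  have hxM : ∀ n, lyapunov w (x n) ≤ M := by
    intro n
    induction n with
    | zero => exact le_max_right _ _
    | succ n ih => exact (hxy n).trans (hyM' n ih)
  set R := ‖w‖ + √M
  have hxR : ∀ n, ‖x n‖ ≤ R := fun n => norm_le_of_lyapunov_le (hxM n)
  have hyR : ∀ n, ‖y n‖ ≤ R := fun n => norm_le_of_lyapunov_le (hyM' n (hxM n))
  have hSR : ∀ n, ‖S n (x n)‖ ≤ R := fun n =>
    norm_le_of_lyapunov_le ((hSle n).trans (hxM n))
  have hR0 : 0 ≤ R := (norm_nonneg _).trans (hxR 0)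
  -- `yₙ - Sₙ xₙ → 0`
  have hyS : Tendsto (fun n => y n - S n (x n)) atTop (𝓝 0) := by
    refine tendsto_sub_of_tendsto_lyapunov hyR hSR ?_
    refine squeeze_zero (g := fun n => 2 * (α n * ((‖u‖ + R) * (R + R))))
      (fun n => lyapunov_nonneg _ _) (fun n => ?_) ?_
    · have h1 := lyapunov_add_lyapunov_comm (y n) (S n (x n))
      have h2 : dualityMap (y n) - dualityMap (S n (x n)) =
          α n • (dualityMap u - dualityMap (S n (x n))) := by
        rw [hJy]; module
      have h3 : (dualityMap u - dualityMap (S n (x n))) (y n - S n (x n)) ≤ (‖u‖ + R) * (R + R) := by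
        refine ((le_abs_self _).trans ((dualityMap u - dualityMap (S n (x n))).le_opNorm _)).trans ?_
        gcongr
        · refine (norm_sub_le _ _).trans ?_
          rw [norm_dualityMap, norm_dualityMap]
          gcongr
          exact hSR n
        · exact (norm_sub_le _ _).trans (add_le_add (hyR n) (hSR n))
      rw [h2, smul_apply, smul_eq_mul] at h1
      have h4 := mul_le_mul_of_nonneg_left h3 (hα_mem n).1.le
      linarith [lyapunov_nonneg (S n (x n)) (y n)]
    · simpa using (hα_lim.mul_const ((‖u‖ + R) * (R + R))).const_mul 2
  set f := dualityMap u - dualityMap w with hf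
  have hfle : ∀ p ∈ commonFixedPoints C S, f (p - w) ≤ 0 := fun p hp => by
    have := hwproj.dualityMap_le hE hFconv hp
    rw [hf, sub_apply]
    linarith
  have hrec : ∀ n, lyapunov w (x (n + 1)) ≤
      (1 - α n) * lyapunov w (S n (x n)) + 2 * α n * f (y n - w) := fun n => by
    have h1 := lyapunov_le_of_dualityMap_eq (hα_mem n) (hJy n) w w
    rw [lyapunov_self] at h1
    linarith [hxy n]
  -- either `φ(w, ·)` decreases by a fixed amount, or the error term is small
  have hdich : ∀ ε > 0, ∃ δ > 0, ∀ᶠ n in atTop,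
      δ ≤ lyapunov w (x n) - lyapunov w (S n (x n)) ∨ f (y n - w) ≤ ε := by
    intro ε hε
    by_contra! hcon
    obtain ⟨τ, hτ, hτP⟩ := extraction_forall_of_frequently
      (fun k : ℕ => hcon (1 / ((k : ℝ) + 1)) (by positivity))
    obtain ⟨U, hU⟩ := Ultrafilter.exists_le (map τ atTop)
    have hUtop : (U : Filter ℕ) ≤ atTop := hU.trans hτ.tendsto_atTop
    obtain ⟨hd, hcl⟩ := hS.tendsto_and_mem_of_ultrafilter hZ hwproj.1 hxC hxM hτ
      (fun k => (hτP k).1) hU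
    obtain ⟨p, hp⟩ := exists_forall_tendsto_of_ultrafilter U x R hxR
    have hlim : Tendsto (fun n => f (y n - w)) U (𝓝 (f (p - w))) := by
      -- `y n - x n = (y n - S n (x n)) + (S n (x n) - x n)` tends to zero, so `y n` has the weak
      -- limit of `x n`.
      have h1 := (f.continuous.tendsto 0).comp ((hyS.mono_left hUtop).add hd |>.trans (by simp))
      have h2 := (h1.add (hp f)).sub_const (f w)
      simp only [map_zero, zero_add, ← map_sub] at h2
      refine h2.congr fun n => ?_
      simp only [Function.comp, map_sub, map_add]
      ring
    have hge : ε ≤ f (p - w) := by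
      refine ge_of_tendsto hlim (hU ?_)
      exact Eventually.of_forall (f := atTop) fun k => (hτP k).2.le
    exact absurd (hfle p (hcl p hp)) (not_le.2 (hε.trans_le hge))
  have hlyap : Tendsto (fun n => lyapunov w (x n)) atTop (𝓝 0) := by
    refine tendsto_zero_of_eventually_le_one_sub_mul_add (fun n => lyapunov_nonneg _ _) hα_mem
      hα_sum fun ε hε => ?_
    obtain ⟨δ, hδ, hev⟩ := hdich (ε / 2) (half_pos hε)
    set B := ‖f‖ * (R + ‖w‖)
    have hfB : ∀ n, f (y n - w) ≤ B := fun n => by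
      refine ((le_abs_self _).trans (f.le_opNorm _)).trans ?_
      exact mul_le_mul_of_nonneg_left
        ((norm_sub_le _ _).trans (add_le_add_left (hyR n) _)) (norm_nonneg _)
    -- Exactly what makes `(1 - α n) * (a - δ) + 2 * α n * B` less than `(1 - α n) * a`.
    have hsmall : ∀ᶠ n in atTop, α n * (δ + 2 * B) < δ := by
      have : Tendsto (fun n => α n * (δ + 2 * B)) atTop (𝓝 0) := by
        simpa using hα_lim.mul_const (δ + 2 * B)
      exact this.eventually (gt_mem_nhds hδ)
    filter_upwards [hev, hsmall] with n h1 h2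
    have h0 := hrec n
    have h3 := (hα_mem n).1
    have h4 := sub_nonneg.2 (hα_mem n).2
    rcases h1 with h1 | h1
    · have h5 := mul_le_mul_of_nonneg_left h1 h4
      have h6 := mul_le_mul_of_nonneg_left (hfB n) h3.le
      have h7 := mul_pos hε h3
      linarith
    · have h5 := mul_le_mul_of_nonneg_left (hSle n) h4
      have h6 := mul_le_mul_of_nonneg_left h1 h3.le
      linarith
  have hfin := tendsto_sub_of_tendsto_lyapunov (a := fun _ => w) (R := max ‖w‖ R)
    (fun _ => le_max_left _ _) (fun n => (hxR n).trans (le_max_right _ _)) hlyap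
  simpa using (tendsto_const_nhds (x := w)).sub hfin
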